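/- An \emph{equipped group} $(G,O)$ is a group $G$ with a subset $O\subset G$ such that $O$ is invariant under conjugation, $\mathbf 1\notin O$, and $O$ is a union of finitely many conjugacy classes. The \emph{factorization semigroup} $S(G,O)$ is generated by the letters $x_g$, $g\in O$, subject to the relations $$x_{g_1}\cdot x_{g_2}=x_{g_2}\cdot x_{g_2^{-1}g_1g_2}=x_{g_1g_2g_1^{-1}}\cdot x_{g_1},\qquad g_1,g_2\in O$$ (the empty product is included). Let $\alpha_G:S(G,O)\to G$ be the product homomorphism, $\alpha_G(x_g)=g$. For $s=x_{g_1}\cdots x_{g_n}\in S(G,O)$ let $G_s$ be the subgroup of $G$ generated by $g_1,\dots,g_n$ (it does not depend on the factorization of $s$), and put $S(G,O)^G=\{s\in S(G,O)\mid G_s=G\}$. A \emph{$C$-group} is an equipped group $(G,Y)$ such that $G$ is generated by the elements of $Y$ with defining relations $g_i^{-1}g_jg_i=g_k$, $(g_i,g_j,g_k)\in M$, for some subset $M\subset Y^3$. Its \emph{$C$-graph} $\Gamma$ is the directed graph with vertex set $Y$ which has an edge from $a$ to $b$ labelled by $g\in Y$ if and only if $g^{-1}ag=b$. The $C$-group is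 called \emph{finite} if $\Gamma$ is a finite graph, i.e. if $Y$ is finite. Let $\Gamma_1,\dots,\Gamma_m$ be the connected components of $\Gamma$. The group $G/[G,G]$ is free abelian of rank $m$, with the natural basis whose $i$-th element is the class of any $y\in Y$ that is a vertex of $\Gamma_i$. For $s\in S(G,Y)$ let $\tau_i(s)$ be the $i$-th coordinate, in this basis, of the class of $\alpha_G(s)$ in $G/[G,G]$. \textbf{Theorem.} For each finite $C$-group $(G,Y)$ there is a constant $T\in\mathbb N$ such that if elements $s_1,s_2\in S(G,Y)^G$ satisfy (i) $\tau_i(s_1)\ge T$ for $i=1,\dots,m$, and (ii) $\alpha_G(s_1)=\alpha_G(s_2)$, then $s_1=s_2$. -/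

import Mathlib

/-- `(G, O)` is an equipped group: `O` is a subset of `G` that is invariant under inner
automorphisms, does not contain `1`, and consists of finitely many conjugacy classes. -/
structure IsEquippedGroup {G : Type*} [Group G] (O : Set G) : Prop where
  conj_mem : ∀ g : G, ∀ a ∈ O, g * a * g⁻¹ ∈ O
  one_notMem : (1 : G) ∉ O
  finite_classes : (ConjClasses.mk '' O).Finite

/-- The relators of the relations `a⁻¹ b a = c`, `(a, b, c) ∈ M`, in the free group on `O`. -/
def cRelators {G : Type*} {O : Set G} (M : Set (O × O × O)) : Set (FreeGroup O) :=
  {r | ∃ a b c : O, (a, b, c) ∈ M ∧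
    r = (FreeGroup.of a)⁻¹ * FreeGroup.of b * FreeGroup.of a * (FreeGroup.of c)⁻¹}

/-- The equipped group `(G, O)` is a C-group: `G` is generated by the elements of `O`, with
defining relations `a⁻¹ b a = c`, `(a, b, c) ∈ M`, for some subset `M` of `O³`. -/
structure IsCGroup {G : Type*} [Group G] (O : Set G) : Prop extends IsEquippedGroup O where
  surjective : Function.Surjective (FreeGroup.lift (fun a : O => (a : G)))
  exists_relations : ∃ M : Set (O × O × O),
    (FreeGroup.lift (fun a : O => (a : G))).ker = Subgroup.normalClosure (cRelators M)

/-- The edges of the C-graph of `(G, O)`, whose set of vertices is `O`: there is an edge with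
tail `a`, head `b` and label `g` if and only if `g⁻¹ a g = b`. -/
def IsCGraphEdge {G : Type*} [Group G] {O : Set G} (a b g : O) : Prop :=
  (g : G)⁻¹ * (a : G) * (g : G) = (b : G)

/-- The set of connected components of the C-graph of `(G, O)`: the quotient of the set of
vertices by the equivalence relation generated by being joined by an edge. -/
def CGraphComponent {G : Type*} [Group G] (O : Set G) : Type _ :=
  Quot (fun a b : O => ∃ g : O, IsCGraphEdge a b g)

/-- The connected component of a vertex of the C-graph. -/
def cGraphComponent {G : Type*} [Group G] {O : Set G} (a : O) : CGraphComponent O :=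
  Quot.mk _ a

/-- The C-group `(G, Y)` is finite: its C-graph is a finite graph, that is, its set of vertices
`Y` is finite (an edge is determined by its tail and its label). -/
structure IsFiniteCGroup {G : Type*} [Group G] (Y : Set G) : Prop extends IsCGroup Y where
  finite : Y.Finite

/-- The defining relations
`x_a x_b = x_b x_{b⁻¹ a b}` and `x_a x_b = x_{a b a⁻¹} x_a` of the factorization semigroup. -/
inductive FactorizationRel {G : Type*} [Group G] (O : Set G) :
    FreeMonoid O → FreeMonoid O → Prop
  | right (a b c : O) (h : (c : G) = (b : G)⁻¹ * (a : G) * (b : G)) :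
      FactorizationRel O (FreeMonoid.of a * FreeMonoid.of b) (FreeMonoid.of b * FreeMonoid.of c)
  | left (a b c : O) (h : (c : G) = (a : G) * (b : G) * (a : G)⁻¹) :
      FactorizationRel O (FreeMonoid.of a * FreeMonoid.of b) (FreeMonoid.of c * FreeMonoid.of a)

/-- The factorization semigroup `S(G, O)` (with the empty product included). -/
abbrev FactorizationSemigroup {G : Type*} [Group G] (O : Set G) : Type _ :=
  PresentedMonoid (FactorizationRel O)

namespace FactorizationSemigroup

/-- The product homomorphism `α : S(G, O) → G`, `x_a ↦ a`. -/
def prodHom {G : Type*} [Group G] (O : Set G) : FactorizationSemigroup O →* G :=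
  PresentedMonoid.lift (fun a : O => (a : G)) (by
    intro u v huv
    cases huv with
    | right a b c h => simp [h, mul_assoc]
    | left a b c h => simp [h, mul_assoc])

/-- The subgroup of `G` generated by the letters of a word. -/
def wordSubgroup {G : Type*} [Group G] {O : Set G} (w : FreeMonoid O) : Subgroup G :=
  Subgroup.closure {g : G | ∃ a ∈ FreeMonoid.toList w, (a : G) = g}

theorem wordSubgroup_mul {G : Type*} [Group G] {O : Set G} (u v : FreeMonoid O) :
    wordSubgroup (u * v) = wordSubgroup u ⊔ wordSubgroup v := by
  unfold wordSubgroup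
  rw [← Subgroup.closure_union]
  congr 1
  ext g
  simp only [FreeMonoid.toList_mul, List.mem_append, Set.mem_ofPred_eq, Set.mem_union]
  constructor
  · rintro ⟨a, ha | ha, rfl⟩
    · exact Or.inl ⟨a, ha, rfl⟩
    · exact Or.inr ⟨a, ha, rfl⟩
  · rintro (⟨a, ha, rfl⟩ | ⟨a, ha, rfl⟩)
    · exact ⟨a, Or.inl ha, rfl⟩
    · exact ⟨a, Or.inr ha, rfl⟩

theorem wordSubgroup_of {G : Type*} [Group G] {O : Set G} (a : O) :
    wordSubgroup (FreeMonoid.of a) = Subgroup.closure {(a : G)} := by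
  unfold wordSubgroup
  congr 1
  ext g
  simp [eq_comm]

/-- The congruence on words of generating the same subgroup. -/
def wordSubgroupCon {G : Type*} [Group G] (O : Set G) : Con (FreeMonoid O) where
  r u v := wordSubgroup u = wordSubgroup v
  iseqv := ⟨fun _ => rfl, fun h => h.symm, fun h k => h.trans k⟩
  mul' h k := by rw [wordSubgroup_mul, wordSubgroup_mul, h, k]

theorem conGen_le_wordSubgroupCon {G : Type*} [Group G] (O : Set G) :
    conGen (FactorizationRel O) ≤ wordSubgroupCon O := by
  rw [Con.conGen_le]
  intro u v huv
  change wordSubgroup u = wordSubgroup v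
  cases huv with
  | right a b c h =>
    rw [wordSubgroup_mul, wordSubgroup_mul]
    simp only [wordSubgroup_of, ← Subgroup.closure_union]
    apply le_antisymm
    · rw [Subgroup.closure_le]
      have hb : (b : G) ∈ Subgroup.closure ({(b : G)} ∪ {(c : G)}) :=
        Subgroup.subset_closure (by simp)
      have hc : (c : G) ∈ Subgroup.closure ({(b : G)} ∪ {(c : G)}) :=
        Subgroup.subset_closure (by simp)
      rintro g (rfl | rfl)
      · have := mul_mem (mul_mem hb hc) (inv_mem hb)
        rw [h] at this ⊢
        simpa [mul_assoc] using this
      · exact hb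
    · rw [Subgroup.closure_le]
      have ha : (a : G) ∈ Subgroup.closure ({(a : G)} ∪ {(b : G)}) :=
        Subgroup.subset_closure (by simp)
      have hb : (b : G) ∈ Subgroup.closure ({(a : G)} ∪ {(b : G)}) :=
        Subgroup.subset_closure (by simp)
      rintro g (rfl | rfl)
      · exact hb
      · rw [h]
        exact mul_mem (mul_mem (inv_mem hb) ha) hb
  | left a b c h =>
    rw [wordSubgroup_mul, wordSubgroup_mul]
    simp only [wordSubgroup_of, ← Subgroup.closure_union]
    apply le_antisymm
    · rw [Subgroup.closure_le]
      have ha : (a : G) ∈ Subgroup.closure ({(c : G)} ∪ {(a : G)}) :=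
        Subgroup.subset_closure (by simp)
      have hc : (c : G) ∈ Subgroup.closure ({(c : G)} ∪ {(a : G)}) :=
        Subgroup.subset_closure (by simp)
      rintro g (rfl | rfl)
      · exact ha
      · have := mul_mem (mul_mem (inv_mem ha) hc) ha
        rw [h] at this ⊢
        simpa [mul_assoc] using this
    · rw [Subgroup.closure_le]
      have ha : (a : G) ∈ Subgroup.closure ({(a : G)} ∪ {(b : G)}) :=
        Subgroup.subset_closure (by simp)
      have hb : (b : G) ∈ Subgroup.closure ({(a : G)} ∪ {(b : G)}) :=
        Subgroup.subset_closure (by simp)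
      rintro g (rfl | rfl)
      · rw [h]
        exact mul_mem (mul_mem ha hb) (inv_mem ha)
      · exact ha

/-- The subgroup `G_s` of `G` generated by the factors of `s`; it does not depend on the
presentation of `s` as a product of generators. -/
def factorSubgroup {G : Type*} [Group G] {O : Set G} (s : FactorizationSemigroup O) :
    Subgroup G :=
  Quotient.liftOn s wordSubgroup (fun _ _ h => conGen_le_wordSubgroupCon O h)

/-- The set `S(G, O)^H` of the elements `s` of `S(G, O)` with `G_s = H`. -/
def withFactorSubgroup {G : Type*} [Group G] (O : Set G) (H : Subgroup G) :
    Set (FactorizationSemigroup O) :=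
  {s | factorSubgroup s = H}

end FactorizationSemigroup

namespace IsCGroup

/-- The homomorphism from `G` to the free abelian group on the connected components of the
C-graph that maps each C-generator to its component. -/
theorem exists_componentHom {G : Type*} [Group G] {Y : Set G} (h : IsCGroup Y) :
    ∃ f : G →* Multiplicative (CGraphComponent Y →₀ ℤ),
      ∀ a : Y, f a = Multiplicative.ofAdd (Finsupp.single (cGraphComponent a) 1) := by
  let φ : FreeGroup Y →* Multiplicative (CGraphComponent Y →₀ ℤ) :=
    FreeGroup.lift (fun a : Y => Multiplicative.ofAdd (Finsupp.single (cGraphComponent a) 1))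
  have hle : (FreeGroup.lift (fun a : Y => (a : G))).ker ≤ φ.ker := by
    obtain ⟨M, hM⟩ := h.exists_relations
    have hmem : ∀ r ∈ cRelators M, FreeGroup.lift (fun a : Y => (a : G)) r = 1 := fun r hr =>
      MonoidHom.mem_ker.1 (hM ▸ Subgroup.subset_normalClosure hr)
    rw [hM]
    refine Subgroup.normalClosure_le_normal ?_
    rintro r hr
    have h1 := hmem r hr
    obtain ⟨a, b, c, -, rfl⟩ := hr
    simp only [map_mul, map_inv, FreeGroup.lift_apply_of] at h1
    have hbc : cGraphComponent b = cGraphComponent c :=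
      Quot.sound ⟨a, mul_inv_eq_one.1 h1⟩
    simp only [SetLike.mem_coe, MonoidHom.mem_ker, map_mul, map_inv, φ, FreeGroup.lift_apply_of,
      hbc]
    rw [mul_inv_eq_one, mul_assoc, mul_comm, mul_assoc, mul_inv_cancel, mul_one]
  refine ⟨MonoidHom.liftOfSurjective _ h.surjective ⟨φ, hle⟩, fun a => ?_⟩
  have := MonoidHom.liftOfRightInverse_comp_apply (FreeGroup.lift (fun a : Y => (a : G)))
    (Function.surjInv h.surjective) (Function.rightInverse_surjInv h.surjective) ⟨φ, hle⟩
    (FreeGroup.of a)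
  simpa [φ] using this

theorem closure_eq_top {G : Type*} [Group G] {Y : Set G} (h : IsCGroup Y) :
    Subgroup.closure Y = ⊤ := by
  have := FreeGroup.range_lift_eq_closure (f := fun a : Y => (a : G))
  rw [Subtype.range_coe] at this
  rw [← this]
  exact MonoidHom.range_eq_top.2 h.surjective

/-- The class in `H₁(G, ℤ) = G / [G, G]` of the C-generators in a connected component. -/
def componentClass {G : Type*} [Group G] {Y : Set G} :
    CGraphComponent Y → Additive (Abelianization G) :=
  Quot.lift (fun a : Y => Additive.ofMul (Abelianization.of (a : G))) (by
    rintro a b ⟨g, hg⟩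
    have hg' : (b : G) = (g : G)⁻¹ * a * g := hg.symm
    simp only [hg', map_mul, map_inv]
    rw [mul_assoc, mul_comm, mul_assoc, mul_inv_cancel, mul_one])

/-- `H₁(G, ℤ) = G / [G, G]` of a C-group `(G, Y)` is a free abelian group: it has a basis
indexed by the connected components of the C-graph, consisting of the classes of the
C-generators. -/
theorem exists_basis {G : Type*} [Group G] {Y : Set G} (h : IsCGroup Y) :
    ∃ b : Module.Basis (CGraphComponent Y) ℤ (Additive (Abelianization G)),
      ∀ a : Y, b (cGraphComponent a) = Additive.ofMul (Abelianization.of (a : G)) := by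
  obtain ⟨f, hf⟩ := h.exists_componentHom
  let F : Additive (Abelianization G) →+ (CGraphComponent Y →₀ ℤ) :=
    MonoidHom.toAdditiveLeft (Abelianization.lift f)
  have hF : ∀ a : Y, F (Additive.ofMul (Abelianization.of (a : G))) =
      Finsupp.single (cGraphComponent a) 1 := by
    intro a
    change Multiplicative.toAdd (Abelianization.lift f (Abelianization.of (a : G))) = _
    rw [Abelianization.lift_apply_of, hf]
    rfl
  let B : (CGraphComponent Y →₀ ℤ) →ₗ[ℤ] Additive (Abelianization G) :=
    Finsupp.linearCombination ℤ componentClass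
  have hB : ∀ a : Y, B (Finsupp.single (cGraphComponent a) 1) =
      Additive.ofMul (Abelianization.of (a : G)) := by
    intro a
    simp only [B, Finsupp.linearCombination_single, one_smul]
    rfl
  have h1 : ∀ x, B (F x) = x := by
    have key : ∀ g : G, B (F (Additive.ofMul (Abelianization.of g))) =
        Additive.ofMul (Abelianization.of g) := by
      intro g
      have hg : g ∈ Subgroup.closure Y := by rw [h.closure_eq_top]; trivial
      induction hg using Subgroup.closure_induction with
      | mem y hy => rw [hF ⟨y, hy⟩, hB ⟨y, hy⟩]
      | one => simp
      | mul x y _ _ hx hy => rw [map_mul, ofMul_mul, map_add, map_add, hx, hy]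
      | inv x _ hx => rw [map_inv, ofMul_inv, map_neg, map_neg, hx]
    intro x
    obtain ⟨g, hg⟩ := QuotientGroup.mk_surjective (Additive.toMul x)
    have := key g
    have e : Additive.ofMul (Abelianization.of g) = x := hg
    rwa [e] at this
  have h2 : ∀ y, F (B y) = y := by
    have : (F.toIntLinearMap ∘ₗ B) = LinearMap.id := by
      ext i
      induction i using Quot.ind with
      | mk a =>
        have := (congrArg F (hB a)).trans (hF a)
        exact DFunLike.congr_fun this _
    exact fun y => LinearMap.congr_fun this y
  let e : Additive (Abelianization G) ≃ₗ[ℤ] (CGraphComponent Y →₀ ℤ) :=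
    LinearEquiv.ofLinearMap F.toIntLinearMap B (LinearMap.ext h2) (LinearMap.ext h1)
  exact ⟨Module.Basis.ofRepr e, fun a => hB a⟩

/-- The natural basis of `H₁(G, ℤ) = G / [G, G]`, indexed by the connected components of the
C-graph and consisting of the classes of the C-generators. -/
noncomputable def h1Basis {G : Type*} [Group G] {Y : Set G} (h : IsCGroup Y) :
    Module.Basis (CGraphComponent Y) ℤ (Additive (Abelianization G)) :=
  h.exists_basis.choose

theorem h1Basis_apply {G : Type*} [Group G] {Y : Set G} (h : IsCGroup Y) (a : Y) :
    h.h1Basis (cGraphComponent a) = Additive.ofMul (Abelianization.of (a : G)) :=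
  h.exists_basis.choose_spec a

/-- The type homomorphism `τ = ab ∘ α`: `h.tau s i` is the `i`-th coordinate of
`ab (α s) ∈ H₁(G, ℤ)` in the natural basis, where `i` is a connected component of the C-graph. -/
noncomputable def tau {G : Type*} [Group G] {Y : Set G} (h : IsCGroup Y)
    (s : FactorizationSemigroup Y) (i : CGraphComponent Y) : ℤ :=
  h.h1Basis.repr
    (Additive.ofMul (Abelianization.of (FactorizationSemigroup.prodHom Y s))) i

end IsCGroup

/-! Write `N` for the order of the permutation group of `Y`. Conjugation by a letter has order
dividing `N`, so every `x_a ^ N` is central. If the factors of `s` generate `G`, then `x_a ^ N * s`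
depends only on the component of `a` (`centralPower_mul_eq`). By pigeonhole, every such `s` is `z ^
k * f`, where `z ^ k` is a product of central powers of component representatives and `f` is one of
finitely many short elements (`exists_eq_componentProd_mul`).

Inverting the central powers makes all letters units, and the defining relations of a C-group hold
among them, so the localization map factors through `α_G`. Hence equal images in `G` give equality
after multiplication by some `z ^ m` (`exists_componentProd_mul_eq_of_prodHom_eq`).

For a fixed pair `f, f'`, one coincidence of images fixes such an `m`. The type `τ` forces every
other coincidence to differ from it by a common shift of exponents, so large exponents contain the
required factor `z ^ m` (`exists_bound_componentProd_mul_eq`). As there are finitely many pairs, one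
bound serves all. -/

open OreLocalization

/-! ### Conjugation and the exchange of letters -/

namespace IsEquippedGroup

variable {G : Type*} [Group G] {O : Set G}

/-- Conjugation by `g` as a permutation of `O`. -/
def conjPerm (h : IsEquippedGroup O) (g : G) : Equiv.Perm O where
  toFun a := ⟨g * a * g⁻¹, h.conj_mem g a a.2⟩
  invFun a := ⟨g⁻¹ * a * g, by simpa using h.conj_mem g⁻¹ a a.2⟩
  left_inv a := Subtype.ext (by simp [mul_assoc])
  right_inv a := Subtype.ext (by simp [mul_assoc])

end IsEquippedGroup

namespace FactorizationSemigroup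

variable {G : Type*} [Group G] {O : Set G}

/-- The generator `x_a` of the factorization semigroup. -/
def letter (a : O) : FactorizationSemigroup O :=
  PresentedMonoid.of (FactorizationRel O) a

theorem prodHom_letter (a : O) : prodHom O (letter a) = a := rfl

theorem factorSubgroup_mul (s t : FactorizationSemigroup O) :
    factorSubgroup (s * t) = factorSubgroup s ⊔ factorSubgroup t := by
  induction s using PresentedMonoid.inductionOn with
  | h u =>
    induction t using PresentedMonoid.inductionOn with
    | h v => exact wordSubgroup_mul u v

theorem factorSubgroup_letter (a : O) :
    factorSubgroup (letter a) = Subgroup.closure {(a : G)} :=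
  wordSubgroup_of a

theorem factorSubgroup_mk (w : FreeMonoid O) :
    factorSubgroup (PresentedMonoid.mk (FactorizationRel O) w) = wordSubgroup w := rfl

theorem factorSubgroup_one : factorSubgroup (1 : FactorizationSemigroup O) = ⊥ := by
  rw [← map_one (PresentedMonoid.mk (FactorizationRel O)), factorSubgroup_mk, wordSubgroup]
  simp

theorem factorSubgroup_letter_pow_le (a : O) (n : ℕ) :
    factorSubgroup (letter a ^ n) ≤ Subgroup.closure {(a : G)} := by
  induction n with
  | zero => simp [factorSubgroup_one]
  | succ n ih =>
    rw [pow_succ, factorSubgroup_mul, factorSubgroup_letter]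
    exact sup_le ih le_rfl

theorem mul_mem_withFactorSubgroup_top (t : FactorizationSemigroup O)
    {s : FactorizationSemigroup O} (hs : s ∈ withFactorSubgroup O (⊤ : Subgroup G)) :
    t * s ∈ withFactorSubgroup O (⊤ : Subgroup G) := by
  have hs' : factorSubgroup s = ⊤ := hs
  change factorSubgroup (t * s) = ⊤
  rw [factorSubgroup_mul, hs', sup_top_eq]

theorem letter_mul_letter (h : IsEquippedGroup O) (a b : O) :
    letter a * letter b = letter (h.conjPerm a b) * letter a :=
  PresentedMonoid.mk_eq_mk_of_rel (FactorizationRel.left a b (h.conjPerm a b) rfl)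

theorem letter_mul_letter_of_eq {a b c : O} (h : (c : G) = (b : G)⁻¹ * a * b) :
    letter a * letter b = letter b * letter c :=
  PresentedMonoid.mk_eq_mk_of_rel (FactorizationRel.right a b c h)

theorem letter_pow_mul_letter_of_eq {a b c : O} (h : (c : G) = (b : G)⁻¹ * a * b) (n : ℕ) :
    letter a ^ n * letter b = letter b * letter c ^ n :=
  ((show SemiconjBy (letter b) (letter c) (letter a) from
    (letter_mul_letter_of_eq h).symm).pow_right n).symm

theorem letter_pow_mul_letter (h : IsEquippedGroup O) (a b : O) (n : ℕ) :
    letter a ^ n * letter b = letter ((h.conjPerm a ^ n) b) * letter a ^ n := by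
  induction n generalizing b with
  | zero => simp
  | succ n ih =>
    rw [pow_succ, mul_assoc, letter_mul_letter h, ← mul_assoc, ih, mul_assoc, ← pow_succ, pow_succ]
    rfl

theorem induction_letter {p : FactorizationSemigroup O → Prop} (one : p 1)
    (letter_mul : ∀ a s, p s → p (letter a * s)) (s : FactorizationSemigroup O) : p s := by
  induction s using PresentedMonoid.inductionOn with
  | h w =>
    induction w using FreeMonoid.inductionOn' with
    | one => exact one
    | of_mul a w ih =>
      rw [map_mul]
      exact letter_mul a _ ih

theorem mem_center_of_commute {z : FactorizationSemigroup O}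
    (hz : ∀ a, Commute z (letter a)) : z ∈ Submonoid.center (FactorizationSemigroup O) := by
  rw [Submonoid.mem_center_iff]
  intro s
  induction s using induction_letter with
  | one => simp
  | letter_mul a s ih => rw [mul_assoc, ih, ← mul_assoc, ← (hz a).eq, mul_assoc]

/-! ### Central powers of letters -/

/-- An exponent `n` for which all powers `x_a ^ n` are central if `O` is finite. -/
noncomputable def centralExponent (O : Set G) : ℕ := Nat.card (Equiv.Perm O)

theorem centralExponent_pos {α : Type*} {O : Set α} [Finite O] : 0 < centralExponent O := Nat.card_pos

/-- Moving `x_a ^ N` past `x_b` applies the `N`-th power of a permutation of `O`, and `N` is the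
order of the permutation group. For infinite `O`, `Nat.card` makes `N = 0` and the claim is trivial.
-/
theorem letter_pow_centralExponent_mem_center (h : IsEquippedGroup O) (a : O) :
    letter a ^ centralExponent O ∈ Submonoid.center (FactorizationSemigroup O) :=
  mem_center_of_commute fun b => by
    rw [Commute, SemiconjBy, letter_pow_mul_letter h, centralExponent, pow_card_eq_one']
    rfl

/-- The central element `x_a ^ n` with `n` the central exponent. -/
noncomputable def centralPower (h : IsEquippedGroup O) (a : O) :
    Submonoid.center (FactorizationSemigroup O) :=
  ⟨letter a ^ centralExponent O, letter_pow_centralExponent_mem_center h a⟩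

/-- A letter that occurs `n` times can be moved `n` times to the front. -/
theorem exists_mk_eq_letter_pow_mul [DecidableEq O] (h : IsEquippedGroup O) (b : O)
    (w : List O) : ∀ n ≤ (w : Multiset O).count b, ∃ t : FactorizationSemigroup O,
      PresentedMonoid.mk (FactorizationRel O) (FreeMonoid.ofList w) = letter b ^ n * t := by
  induction w with
  | nil => intro n hn; exact ⟨1, by simp_all⟩
  | cons a w ih =>
    have hmk : PresentedMonoid.mk (FactorizationRel O) (FreeMonoid.ofList (a :: w)) =
        letter a * PresentedMonoid.mk (FactorizationRel O) (FreeMonoid.ofList w) := rfl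
    intro n hn
    rw [hmk]
    by_cases hab : a = b
    · subst hab
      cases n with
      | zero => exact ⟨_, by rw [pow_zero, one_mul]⟩
      | succ n =>
        obtain ⟨t, ht⟩ := ih n (by rwa [← Multiset.cons_coe, Multiset.count_cons_self, Nat.succ_le_succ_iff] at hn)
        exact ⟨t, by rw [ht, pow_succ', mul_assoc]⟩
    · obtain ⟨t, ht⟩ := ih n (by rwa [← Multiset.cons_coe, Multiset.count_cons_of_ne (Ne.symm hab)] at hn)
      -- Moving `x_a` to the right across `x_b ^ n` conjugates it by `b ^ (-n)` and leaves the power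
      -- unchanged.
      refine ⟨letter ((h.conjPerm b ^ n).symm a) * t, ?_⟩
      rw [ht, ← mul_assoc, ← mul_assoc, letter_pow_mul_letter h, Equiv.apply_symm_apply]

/-! ### Exchanging central powers within a component -/

/-- The elements `h` such that the central powers of letters conjugate under `h` have the same
product with `s`. -/
def swapSubgroup (h : IsEquippedGroup O) (s : FactorizationSemigroup O) : Subgroup G where
  carrier := {g | ∀ a b : O, (b : G) = g⁻¹ * a * g →
    (centralPower h a : FactorizationSemigroup O) * s = centralPower h b * s}
  one_mem' a b hab := by
    rw [show a = b from Subtype.ext (by simpa using hab.symm)]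
  mul_mem' {g k} hg hk a b hab := by
    refine (hg a ((h.conjPerm g).symm a) rfl).trans (hk _ _ ?_)
    simp [hab, IsEquippedGroup.conjPerm, mul_assoc]
  inv_mem' {g} hg a b hab := by
    refine (hg b a ?_).symm
    simp [hab, mul_assoc]

/-- With `b = g⁻¹ a g`, `x_a ^ N x_g = x_g x_b ^ N`, and `x_b ^ N` is central. -/
theorem letter_mem_swapSubgroup (h : IsEquippedGroup O) (g : O) (t : FactorizationSemigroup O) :
    (g : G) ∈ swapSubgroup h (letter g * t) := by
  intro a b hab
  have hb := Submonoid.mem_center_iff.1 (centralPower h b).2 (letter g)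
  rw [← mul_assoc, ← mul_assoc, ← hb]
  exact congrArg (· * t) (letter_pow_mul_letter_of_eq hab _)

/-- Each letter of a word for `s` can be moved to the front, where the previous lemma applies. -/
theorem factorSubgroup_le_swapSubgroup (h : IsEquippedGroup O) (s : FactorizationSemigroup O) :
    factorSubgroup s ≤ swapSubgroup h s := by
  classical
  induction s using PresentedMonoid.inductionOn with
  | h w =>
    rw [factorSubgroup_mk, wordSubgroup, Subgroup.closure_le]
    rintro _ ⟨a, ha, rfl⟩
    obtain ⟨t, ht⟩ := exists_mk_eq_letter_pow_mul h a (FreeMonoid.toList w) 1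
      (Multiset.one_le_count_iff_mem.2 ha)
    rw [FreeMonoid.ofList_toList, pow_one] at ht
    rw [ht]
    exact letter_mem_swapSubgroup h a t

/-- The swap subgroup is all of `G`, so the exchange works along every edge of the C-graph, hence
along paths. -/
theorem centralPower_mul_eq (h : IsEquippedGroup O) {a b : O}
    (hab : cGraphComponent a = cGraphComponent b) {s : FactorizationSemigroup O}
    (hs : s ∈ withFactorSubgroup O (⊤ : Subgroup G)) :
    (centralPower h a : FactorizationSemigroup O) * s = centralPower h b * s := by
  have htop : swapSubgroup h s = ⊤ := top_le_iff.1 (hs ▸ factorSubgroup_le_swapSubgroup h s)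
  have hmem : ∀ g : G, g ∈ swapSubgroup h s := fun g => htop ▸ Subgroup.mem_top g
  have hgen := Quot.eqvGen_exact hab
  clear hab
  induction hgen with
  | rel a b hab =>
    obtain ⟨g, hg⟩ := hab
    exact hmem g a b hg.symm
  | refl a => rfl
  | symm a b r ih => exact ih.symm
  | trans a b c r r' ih ih' => exact ih.trans ih'

/-! ### Products of central powers indexed by components -/

/-- The central power of a chosen representative of a component of the C-graph. -/
noncomputable def componentPower (h : IsEquippedGroup O) (i : CGraphComponent O) :
    Submonoid.center (FactorizationSemigroup O) :=
  centralPower h i.out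

theorem centralPower_mul_eq_componentPower_mul (h : IsEquippedGroup O) (a : O)
    {s : FactorizationSemigroup O} (hs : s ∈ withFactorSubgroup O (⊤ : Subgroup G)) :
    (centralPower h a : FactorizationSemigroup O) * s =
      componentPower h (cGraphComponent a) * s :=
  centralPower_mul_eq h (Quot.out_eq (cGraphComponent a)).symm hs

instance [Finite O] : Finite (CGraphComponent O) :=
  inferInstanceAs (Finite (Quot _))

noncomputable instance [Finite O] : Fintype (CGraphComponent O) := Fintype.ofFinite _

/-- The product of the central powers of representatives with exponents `k`. -/
noncomputable def componentProd [Finite O] (h : IsEquippedGroup O) (k : CGraphComponent O → ℕ) :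
    Submonoid.center (FactorizationSemigroup O) :=
  ∏ i, componentPower h i ^ k i

theorem componentProd_add [Finite O] (h : IsEquippedGroup O) (k l : CGraphComponent O → ℕ) :
    componentProd h (k + l) = componentProd h k * componentProd h l := by
  simp [componentProd, pow_add, Finset.prod_mul_distrib]

theorem componentProd_zero [Finite O] (h : IsEquippedGroup O) :
    componentProd h (0 : CGraphComponent O → ℕ) = 1 := by
  simp [componentProd]

theorem componentProd_single [Finite O] [DecidableEq (CGraphComponent O)] (h : IsEquippedGroup O)
    (i : CGraphComponent O) : componentProd h (Pi.single i 1) = componentPower h i := by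
  rw [componentProd, Finset.prod_eq_single i]
  · simp
  · intro j _ hj
    simp [hj]
  · simp

/-- The submonoid generated by the central powers of the letters. -/
def centralPowers (h : IsEquippedGroup O) : Submonoid (FactorizationSemigroup O) :=
  Submonoid.closure (Set.range fun a => (centralPower h a : FactorizationSemigroup O))

theorem centralPowers_le_center (h : IsEquippedGroup O) :
    centralPowers h ≤ Submonoid.center (FactorizationSemigroup O) := by
  rw [centralPowers, Submonoid.closure_le]
  rintro _ ⟨a, rfl⟩
  exact (centralPower h a).2

/-- The exponents `k` do not depend on `s`; this lets one normal form act on both sides of an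
equation. -/
theorem exists_componentProd_mul_eq [Finite O] (h : IsEquippedGroup O)
    {z : FactorizationSemigroup O} (hz : z ∈ centralPowers h) :
    ∃ k, ∀ s ∈ withFactorSubgroup O (⊤ : Subgroup G),
      z * s = (componentProd h k : FactorizationSemigroup O) * s := by
  classical
  induction hz using Submonoid.closure_induction with
  | mem z hz =>
    obtain ⟨a, rfl⟩ := hz
    refine ⟨Pi.single (cGraphComponent a) 1, fun s hs => ?_⟩
    rw [componentProd_single]
    exact centralPower_mul_eq_componentPower_mul h a hs
  | one => exact ⟨0, fun s _ => by rw [componentProd_zero]; rfl⟩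
  | mul z z' _ _ ih ih' =>
    obtain ⟨k, hk⟩ := ih
    obtain ⟨k', hk'⟩ := ih'
    refine ⟨k + k', fun s hs => ?_⟩
    rw [mul_assoc, hk _ (mul_mem_withFactorSubgroup_top z' hs), hk' s hs, componentProd_add,
      Submonoid.coe_mul, mul_assoc]

/-! ### Localization at the central powers -/

noncomputable instance (h : IsEquippedGroup O) : OreSet (centralPowers h) where
  ore_right_cancel r₁ r₂ s hs := ⟨s, by
    have hc := Submonoid.mem_center_iff.1 (centralPowers_le_center h s.2)
    rw [← hc, ← hc, hs]⟩
  oreNum r _ := r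
  oreDenom _ s := s
  ore_eq r s := (Submonoid.mem_center_iff.1 (centralPowers_le_center h s.2) r).symm

/-- Elements of the factorization semigroup with the same image in the localization at the central
powers become equal after multiplication by a product of central powers. -/
theorem exists_mul_eq_mul_of_numeratorHom_eq (h : IsEquippedGroup O)
    {s t : FactorizationSemigroup O}
    (hst : (numeratorHom s : OreLocalization (centralPowers h) (FactorizationSemigroup O)) =
      numeratorHom t) : ∃ z ∈ centralPowers h, z * s = z * t := by
  rw [numeratorHom_apply, numeratorHom_apply, oreDiv_eq_iff] at hst
  obtain ⟨u, v, huv, huv'⟩ := hst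
  rw [Submonoid.coe_one, mul_one, mul_one] at huv'
  refine ⟨u, u.2, ?_⟩
  rw [Submonoid.smul_def, smul_eq_mul, smul_eq_mul, ← huv'] at huv
  exact huv.symm

theorem isUnit_numeratorHom_letter [Finite O] (h : IsEquippedGroup O) (a : O) :
    IsUnit (numeratorHom (letter a) :
      OreLocalization (centralPowers h) (FactorizationSemigroup O)) := by
  have hz : (centralPower h a : FactorizationSemigroup O) ∈ centralPowers h :=
    Submonoid.subset_closure ⟨a, rfl⟩
  have := numerator_isUnit (⟨_, hz⟩ : centralPowers h)
  change IsUnit (numeratorHom (letter a ^ centralExponent O)) at this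
  rw [map_pow] at this
  exact (isUnit_pow_iff centralExponent_pos.ne').1 this

/-- The localization at the central powers admits a homomorphism from the C-group. -/
theorem exists_hom_units_localization [Finite O] (h : IsCGroup O) :
    ∃ f : G →* (OreLocalization (centralPowers h.toIsEquippedGroup)
        (FactorizationSemigroup O))ˣ,
      ∀ a : O, (f a : OreLocalization (centralPowers h.toIsEquippedGroup)
        (FactorizationSemigroup O)) = numeratorHom (letter a) := by
  let φ : FreeGroup O →* (OreLocalization (centralPowers h.toIsEquippedGroup)
        (FactorizationSemigroup O))ˣ :=
    FreeGroup.lift fun a => (isUnit_numeratorHom_letter h.toIsEquippedGroup a).unit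
  have hle : (FreeGroup.lift (fun a : O => (a : G))).ker ≤ φ.ker := by
    obtain ⟨M, hM⟩ := h.exists_relations
    have hmem : ∀ r ∈ cRelators M, FreeGroup.lift (fun a : O => (a : G)) r = 1 := fun r hr =>
      MonoidHom.mem_ker.1 (hM ▸ Subgroup.subset_normalClosure hr)
    rw [hM]
    refine Subgroup.normalClosure_le_normal ?_
    rintro r hr
    have h1 := hmem r hr
    obtain ⟨a, b, c, -, rfl⟩ := hr
    simp only [map_mul, map_inv, FreeGroup.lift_apply_of] at h1
    -- A defining relation `a⁻¹ b a = c` of the C-group is matched by the semigroup relation `x_b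
    -- x_a = x_a x_c`.
    have hbc := letter_mul_letter_of_eq (mul_inv_eq_one.1 h1).symm
    simp only [SetLike.mem_coe, MonoidHom.mem_ker, map_mul, map_inv, φ, FreeGroup.lift_apply_of]
    rw [mul_inv_eq_one, mul_assoc, inv_mul_eq_iff_eq_mul]
    ext
    simp only [Units.val_mul, IsUnit.unit_spec, ← map_mul, hbc]
  refine ⟨MonoidHom.liftOfSurjective _ h.surjective ⟨φ, hle⟩, fun a => ?_⟩
  have := MonoidHom.liftOfRightInverse_comp_apply (FreeGroup.lift (fun a : O => (a : G)))
    (Function.surjInv h.surjective) (Function.rightInverse_surjInv h.surjective) ⟨φ, hle⟩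
    (FreeGroup.of a)
  rw [FreeGroup.lift_apply_of] at this
  exact (congrArg Units.val this).trans (by simp [φ])

theorem exists_componentProd_mul_eq_of_prodHom_eq [Finite O] (h : IsCGroup O)
    {s t : FactorizationSemigroup O} (hs : s ∈ withFactorSubgroup O (⊤ : Subgroup G))
    (ht : t ∈ withFactorSubgroup O (⊤ : Subgroup G)) (hst : prodHom O s = prodHom O t) :
    ∃ k, (componentProd h.toIsEquippedGroup k : FactorizationSemigroup O) * s =
      componentProd h.toIsEquippedGroup k * t := by
  obtain ⟨f, hf⟩ := exists_hom_units_localization h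
  -- Both homomorphisms agree on letters, so the localization map sees only the image in `G`.
  have hcomp : ((Units.coeHom _).comp f).comp (prodHom O) = numeratorHom :=
    PresentedMonoid.ext _ hf
  obtain ⟨z, hz, hzst⟩ := exists_mul_eq_mul_of_numeratorHom_eq h.toIsEquippedGroup (s := s) (t := t)
    (by rw [← hcomp]; simp [hst])
  obtain ⟨k, hk⟩ := exists_componentProd_mul_eq h.toIsEquippedGroup hz
  exact ⟨k, by rw [← hk s hs, ← hk t ht, hzst]⟩

/-! ### Reduction to finitely many short elements -/

/-- The elements of bounded length whose factors generate `G`. -/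
def shortElements (O : Set G) : Set (FactorizationSemigroup O) :=
  {s | s ∈ withFactorSubgroup O (⊤ : Subgroup G) ∧ ∃ w : List O,
    w.length ≤ Nat.card O * centralExponent O ∧
      PresentedMonoid.mk (FactorizationRel O) (FreeMonoid.ofList w) = s}

theorem finite_shortElements [Finite O] : (shortElements O).Finite :=
  ((List.finite_length_le O (Nat.card O * centralExponent O)).image fun w =>
    PresentedMonoid.mk (FactorizationRel O) (FreeMonoid.ofList w)).subset
      fun _ hs => hs.2

/-- The number of letters of an element of the factorization semigroup. -/
def lengthHom (O : Set G) : FactorizationSemigroup O →* Multiplicative ℕ :=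
  PresentedMonoid.lift (fun _ => Multiplicative.ofAdd 1) (by
    intro u v huv
    cases huv <;> simp)

theorem lengthHom_letter (a : O) : lengthHom O (letter a) = Multiplicative.ofAdd 1 := rfl

/-- A long element whose factors generate `G` is divisible by the central power of a letter. -/
theorem exists_eq_centralPower_mul [Finite O] (h : IsEquippedGroup O)
    {s : FactorizationSemigroup O} (hs : s ∈ withFactorSubgroup O (⊤ : Subgroup G))
    (hs' : s ∉ shortElements O) : ∃ (a : O) (t : FactorizationSemigroup O),
      t ∈ withFactorSubgroup O (⊤ : Subgroup G) ∧ s = centralPower h a * t := by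
  classical
  have := Fintype.ofFinite O
  obtain ⟨w, rfl⟩ : ∃ w : List O,
      PresentedMonoid.mk (FactorizationRel O) (FreeMonoid.ofList w) = s :=
    PresentedMonoid.surjective_mk s
  have hw : Nat.card O * centralExponent O < w.length := by
    by_contra! hle
    exact hs' ⟨hs, w, hle, rfl⟩
  obtain ⟨a, ha⟩ : ∃ a, centralExponent O < (w : Multiset O).count a := by
    by_contra! hle
    have hsum := Multiset.sum_count_eq_card (s := Finset.univ) (m := (w : Multiset O)) (by simp)
    have hle' := Finset.sum_le_sum fun a (_ : a ∈ Finset.univ) => hle a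
    simp only [Finset.sum_const, Finset.card_univ, smul_eq_mul, Multiset.coe_card, Nat.card_eq_fintype_card] at hsum hle' hw
    omega
  obtain ⟨t, ht⟩ := exists_mk_eq_letter_pow_mul h a w (centralExponent O + 1) ha
  -- Of the `N + 1` copies of `x_a`, one stays in the cofactor so that its factors still generate
  -- `G`.
  refine ⟨a, letter a * t, ?_, by rw [ht, pow_succ, mul_assoc]; rfl⟩
  have hs'' : factorSubgroup _ = ⊤ := hs
  change factorSubgroup _ = ⊤
  rw [ht, pow_succ, mul_assoc, factorSubgroup_mul] at hs''
  rw [← hs'', eq_comm, sup_eq_right, factorSubgroup_mul, factorSubgroup_letter]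
  exact (factorSubgroup_letter_pow_le a _).trans le_sup_left

/-- Induction on length, splitting off one central power at a time. The cofactor still generates
`G`, so that power may be replaced by the one of its component's representative. -/
theorem exists_eq_componentProd_mul [Finite O] (h : IsEquippedGroup O)
    {s : FactorizationSemigroup O} (hs : s ∈ withFactorSubgroup O (⊤ : Subgroup G)) :
    ∃ k, ∃ t ∈ shortElements O, s = componentProd h k * t := by
  classical
  induction hn : (lengthHom O s).toAdd using Nat.strong_induction_on generalizing s with
  | _ n ih =>
    by_cases hs' : s ∈ shortElements O
    · exact ⟨0, s, hs', by rw [componentProd_zero, Submonoid.coe_one, one_mul]⟩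
    obtain ⟨a, t, ht, rfl⟩ := exists_eq_centralPower_mul h hs hs'
    have hlen : (lengthHom O t).toAdd < n := by
      have := centralExponent_pos (O := O)
      rw [← hn]
      change _ < (lengthHom O (letter a ^ centralExponent O * t)).toAdd
      simpa [lengthHom_letter] using this
    obtain ⟨k, u, hu, hk⟩ := ih _ hlen ht rfl
    refine ⟨Pi.single (cGraphComponent a) 1 + k, u, hu, ?_⟩
    rw [centralPower_mul_eq_componentPower_mul h a ht, componentProd_add, componentProd_single,
      Submonoid.coe_mul, mul_assoc, ← hk]

end FactorizationSemigroup

/-! ### The type homomorphism and the uniform bound -/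

namespace IsCGroup

open FactorizationSemigroup

variable {G : Type*} [Group G] {Y : Set G}

theorem tau_mul (h : IsCGroup Y) (s t : FactorizationSemigroup Y) (i : CGraphComponent Y) :
    h.tau (s * t) i = h.tau s i + h.tau t i := by
  simp [tau]

theorem tau_one (h : IsCGroup Y) (i : CGraphComponent Y) :
    h.tau 1 i = 0 := by
  simp [tau]

theorem tau_congr (h : IsCGroup Y) {s t : FactorizationSemigroup Y}
    (hst : prodHom Y s = prodHom Y t) (i : CGraphComponent Y) : h.tau s i = h.tau t i := by
  rw [tau, tau, hst]

/-- `τ_i` as a monoid homomorphism. -/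
noncomputable def tauHom (h : IsCGroup Y) (i : CGraphComponent Y) :
    FactorizationSemigroup Y →* Multiplicative ℤ where
  toFun s := Multiplicative.ofAdd (h.tau s i)
  map_one' := by rw [tau_one, ofAdd_zero]
  map_mul' s t := by rw [tau_mul, ofAdd_add]

theorem tau_letter [DecidableEq (CGraphComponent Y)] (h : IsCGroup Y) (a : Y)
    (i : CGraphComponent Y) :
    h.tau (letter a) i = if cGraphComponent a = i then 1 else 0 := by
  rw [tau, prodHom_letter, ← h1Basis_apply h, Module.Basis.repr_self, Finsupp.single_apply]

theorem tau_componentProd [Finite Y] (h : IsCGroup Y) (k : CGraphComponent Y → ℕ)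
    (i : CGraphComponent Y) :
    h.tau (componentProd h.toIsEquippedGroup k : FactorizationSemigroup Y) i =
      centralExponent Y * k i := by
  classical
  have hpow (j : CGraphComponent Y) :
      h.tauHom i (componentPower h.toIsEquippedGroup j : FactorizationSemigroup Y) =
        Multiplicative.ofAdd (if j = i then (centralExponent Y : ℤ) else 0) := by
    change h.tauHom i (letter j.out ^ centralExponent Y) = _
    rw [map_pow]
    change Multiplicative.ofAdd (h.tau (letter j.out) i) ^ _ = _
    rw [tau_letter, show cGraphComponent j.out = j from Quot.out_eq j, ← ofAdd_nsmul]
    simp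
  have : ((h.tauHom i).comp (Submonoid.subtype _)) (componentProd h.toIsEquippedGroup k) =
      Multiplicative.ofAdd (centralExponent Y * k i : ℤ) := by
    rw [componentProd, map_prod]
    simp only [map_pow, MonoidHom.comp_apply, Submonoid.subtype_apply, hpow, ← ofAdd_nsmul]
    rw [← ofAdd_sum]
    simp [mul_comm]
  exact this

/-- For fixed `f` and `f'`, the products of `f` and `f'` with large central elements are determined
by their images in `G`. -/
theorem exists_bound_componentProd_mul_eq [Finite Y] (h : IsCGroup Y)
    {f f' : FactorizationSemigroup Y} (hf : f ∈ withFactorSubgroup Y (⊤ : Subgroup G))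
    (hf' : f' ∈ withFactorSubgroup Y (⊤ : Subgroup G)) :
    ∃ K : ℕ, ∀ k k' : CGraphComponent Y → ℕ, (∀ i, K ≤ k i) →
      prodHom Y (componentProd h.toIsEquippedGroup k * f) =
        prodHom Y (componentProd h.toIsEquippedGroup k' * f') →
      (componentProd h.toIsEquippedGroup k : FactorizationSemigroup Y) * f =
        componentProd h.toIsEquippedGroup k' * f' := by
  by_cases hex : ∃ l l', prodHom Y (componentProd h.toIsEquippedGroup l * f) =
      prodHom Y (componentProd h.toIsEquippedGroup l' * f')
  · obtain ⟨l, l', hl⟩ := hex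
    obtain ⟨m, hm⟩ := exists_componentProd_mul_eq_of_prodHom_eq h
      (mul_mem_withFactorSubgroup_top _ hf) (mul_mem_withFactorSubgroup_top _ hf') hl
    -- The sum is a single number that dominates every `m i + l i`.
    refine ⟨∑ i, (m i + l i), fun k k' hk hkk' => ?_⟩
    have hle (i) : m i + l i ≤ k i :=
      (Finset.single_le_sum (f := fun i => m i + l i) (fun _ _ => Nat.zero_le _)
        (Finset.mem_univ i)).trans (hk i)
    -- Both coincidences give `τ_i(f') - τ_i(f)`, as `N (l i - l' i)` and as `N (k i - k' i)`.
    have hsub (i) : (k i : ℤ) + l' i = k' i + l i := by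
      have h1 := h.tau_congr hl i
      have h2 := h.tau_congr hkk' i
      simp only [tau_mul, tau_componentProd] at h1 h2
      have hpos : (centralExponent Y : ℤ) ≠ 0 := by exact_mod_cast centralExponent_pos.ne'
      refine mul_left_cancel₀ hpos ?_
      linarith
    -- Both exponent vectors contain the shift `k - (m + l)`, where the truncated subtraction is
    -- exact; the rest is the known equality of `z ^ (m + l) * f` and `z ^ (m + l') * f'`.
    have hk1 : k = (k - (m + l)) + (m + l) := by
      funext i
      have := hle i
      simp only [Pi.add_apply, Pi.sub_apply]
      omega
    have hk2 : k' = (k - (m + l)) + (m + l') := by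
      funext i
      have := hle i
      have := hsub i
      simp only [Pi.add_apply, Pi.sub_apply]
      omega
    rw [hk2]
    conv_lhs => rw [hk1]
    simp only [componentProd_add, Submonoid.coe_mul, mul_assoc]
    rw [hm]
  -- If the images of the two families never meet, any bound works.
  · exact ⟨0, fun k k' _ hkk' => (hex ⟨k, k', hkk'⟩).elim⟩

end IsCGroup

open FactorizationSemigroup in
theorem mainTheorem7 {G : Type*} [Group G] (Y : Set G) (hY : IsFiniteCGroup Y) :
    ∃ T : ℕ, ∀ s₁ ∈ FactorizationSemigroup.withFactorSubgroup Y (⊤ : Subgroup G),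
      ∀ s₂ ∈ FactorizationSemigroup.withFactorSubgroup Y (⊤ : Subgroup G),
        (∀ i : CGraphComponent Y, (T : ℤ) ≤ hY.toIsCGroup.tau s₁ i) →
        FactorizationSemigroup.prodHom Y s₁ = FactorizationSemigroup.prodHom Y s₂ →
        s₁ = s₂ := by
  have := hY.finite.to_subtype
  have h := hY.toIsCGroup
  have hfin : Finite (shortElements Y) := finite_shortElements.to_subtype
  choose K hK using fun p : shortElements Y × shortElements Y =>
    h.exists_bound_componentProd_mul_eq p.1.2.1 p.2.2.1
  obtain ⟨K₀, hK₀⟩ := (Set.finite_range K).bddAbove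
  obtain ⟨B, hB⟩ := (Set.finite_range fun p : shortElements Y × CGraphComponent Y =>
    (h.tau p.1 p.2).toNat).bddAbove
  -- `B` bounds the types of short elements, so `N * k i + τ_i(f) ≥ N * K₀ + B` forces `k i ≥ K₀`.
  refine ⟨centralExponent Y * K₀ + B, fun s₁ hs₁ s₂ hs₂ hT hα => ?_⟩
  obtain ⟨k, f, hf, rfl⟩ := exists_eq_componentProd_mul h.toIsEquippedGroup hs₁
  obtain ⟨k', f', hf', rfl⟩ := exists_eq_componentProd_mul h.toIsEquippedGroup hs₂
  refine hK (⟨f, hf⟩, ⟨f', hf'⟩) k k' (fun i => (hK₀ ⟨_, rfl⟩).trans ?_) hα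
  have hTi := hT i
  have hBi : (h.tau f i).toNat ≤ B := hB ⟨(⟨f, hf⟩, i), rfl⟩
  have hBi' : h.tau f i ≤ B := Int.toNat_le.1 hBi
  rw [IsCGroup.tau_mul, IsCGroup.tau_componentProd] at hTi
  have hpos : (0 : ℤ) < centralExponent Y := by exact_mod_cast centralExponent_pos
  push_cast at hTi
  have : (centralExponent Y : ℤ) * K₀ ≤ centralExponent Y * k i := by linarith
  exact_mod_cast le_of_mul_le_mul_left this hpos
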